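/- Let $H_1,H_2$ be complex Hilbert spaces with $H_1\neq\{0\}$, and let $T$ be a densely defined closed linear operator from its domain $D(T)\subseteq H_1$ into $H_2$. For such an operator $S$ with domain $D(S)$ put $$m(S)=\inf\{\|Sx\| : x\in D(S),\ \|x\|=1\},$$ and call $S$ minimum attaining if $\|Sx_0\|=m(S)$ for some $x_0\in D(S)$ with $\|x_0\|=1$. Let $$F_T=T(I+T^*T)^{-1/2}$$ be the bounded transform of $T$, a bounded operator defined on all of $H_1$; here $(I+T^*T)^{-1/2}$ is the positive square root of the bounded positive operator $(I+T^*T)^{-1}$ on $H_1$. Then: 1. $m(F_T)=\dfrac{m(T)}{\sqrt{1+m(T)^2}}$; 2. $m(F_T)<1$ and $m(T)^2=\dfrac{m(F_T)^2}{1-m(F_T)^2}$; 3. $T$ is minimum attaining if and only if $F_T$ is minimum attaining. -/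

import Mathlib

namespace UnboundedOperator

open scoped InnerProductSpace LinearPMap
open Filter Topology

section Basic

variable {E F G : Type*}
  [NormedAddCommGroup E] [InnerProductSpace ℂ E]
  [NormedAddCommGroup F] [InnerProductSpace ℂ F]
  [NormedAddCommGroup G] [InnerProductSpace ℂ G]

/-- The minimum modulus `m(T) = inf {‖T x‖ : x ∈ D(T), ‖x‖ = 1}`. -/
noncomputable def minModulus (T : E →ₗ.[ℂ] F) : ℝ :=
  sInf {r : ℝ | ∃ x : T.domain, ‖(x : E)‖ = 1 ∧ ‖T x‖ = r}

/-- `T` is minimum attaining: `‖T x₀‖ = m(T)` for some unit vector `x₀ ∈ D(T)`. -/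
def IsMinAttaining (T : E →ₗ.[ℂ] F) : Prop :=
  ∃ x₀ : T.domain, ‖(x₀ : E)‖ = 1 ∧ ‖T x₀‖ = minModulus T

/-- The product `S T` of two operators, with `D(S T) = {x ∈ D(T) : T x ∈ D(S)}`. -/
def prodOp (S : F →ₗ.[ℂ] G) (T : E →ₗ.[ℂ] F) : E →ₗ.[ℂ] G where
  domain :=
    { carrier := {x | ∃ h : x ∈ T.domain, T ⟨x, h⟩ ∈ S.domain}
      zero_mem' := ⟨T.domain.zero_mem, by
        have h : T ⟨0, T.domain.zero_mem⟩ = 0 := T.map_zero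
        rw [h]; exact S.domain.zero_mem⟩
      add_mem' := by
        rintro x y ⟨hx, hx'⟩ ⟨hy, hy'⟩
        refine ⟨T.domain.add_mem hx hy, ?_⟩
        have h : T ⟨x + y, T.domain.add_mem hx hy⟩ = T ⟨x, hx⟩ + T ⟨y, hy⟩ :=
          T.map_add ⟨x, hx⟩ ⟨y, hy⟩
        rw [h]; exact S.domain.add_mem hx' hy'
      smul_mem' := by
        rintro c x ⟨hx, hx'⟩
        refine ⟨T.domain.smul_mem c hx, ?_⟩
        have h : T ⟨c • x, T.domain.smul_mem c hx⟩ = c • T ⟨x, hx⟩ :=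
          T.map_smul c ⟨x, hx⟩
        rw [h]; exact S.domain.smul_mem c hx' }
  toFun :=
    { toFun := fun x => S ⟨T ⟨x, x.2.fst⟩, x.2.snd⟩
      map_add' := by
        intro x y
        rw [← S.map_add]
        congr 1
        exact Subtype.ext (T.map_add ⟨x, x.2.fst⟩ ⟨y, y.2.fst⟩)
      map_smul' := by
        intro c x
        rw [RingHom.id_apply, ← S.map_smul]
        congr 1
        exact Subtype.ext (T.map_smul c ⟨x, x.2.fst⟩) }

/-- The everywhere defined identity operator. -/
def idOp (E : Type*) [NormedAddCommGroup E] [InnerProductSpace ℂ E] : E →ₗ.[ℂ] E :=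
  (LinearMap.id : E →ₗ[ℂ] E).toPMap ⊤

/-- A bounded operator, as an operator with domain the whole space. -/
def ofBounded (A : E →L[ℂ] F) : E →ₗ.[ℂ] F :=
  (A : E →ₗ[ℂ] F).toPMap ⊤

/-- The bounded, everywhere defined operator `R` is the inverse of the operator `A`:
`R` maps into `D(A)`, `A R y = y` for all `y`, and `R A x = x` for all `x ∈ D(A)`. -/
def IsBoundedInverse (A : E →ₗ.[ℂ] E) (R : E →L[ℂ] E) : Prop :=
  (∀ y : E, ∃ h : R y ∈ A.domain, A ⟨R y, h⟩ = y) ∧ ∀ x : A.domain, R (A x) = x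

theorem IsBoundedInverse.unique {A : E →ₗ.[ℂ] E} {R R' : E →L[ℂ] E}
    (h : IsBoundedInverse A R) (h' : IsBoundedInverse A R') : R = R' := by
  ext y
  obtain ⟨hy, e⟩ := h.1 y
  have := h'.2 ⟨R y, hy⟩
  rw [e] at this
  exact this.symm

end Basic

section Transform

variable {H₁ H₂ : Type*}
  [NormedAddCommGroup H₁] [InnerProductSpace ℂ H₁] [CompleteSpace H₁]
  [NormedAddCommGroup H₂] [InnerProductSpace ℂ H₂]

/-- The operator `I + T* T`, where `T* = T†` is the Hilbert space adjoint. -/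
noncomputable def onePlusGram (T : H₁ →ₗ.[ℂ] H₂) : H₁ →ₗ.[ℂ] H₁ :=
  idOp H₁ + prodOp T† T

theorem onePlusGram_inner (T : H₁ →ₗ.[ℂ] H₂) (hd : Dense (T.domain : Set H₁))
    (x : (onePlusGram T).domain) (u : T.domain) :
    ⟪onePlusGram T x, (u : H₁)⟫_ℂ = ⟪(x : H₁), (u : H₁)⟫_ℂ + ⟪T ⟨x, x.2.2.fst⟩, T u⟫_ℂ := by
  have h := LinearPMap.adjoint_isFormalAdjoint hd ⟨T ⟨x, x.2.2.fst⟩, x.2.2.snd⟩ u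
  rw [← h, ← inner_add_left]
  rfl

variable [CompleteSpace H₂]

/-- For densely defined closed `T`, the operator `I + T* T` has a bounded everywhere
defined inverse. -/
theorem exists_isBoundedInverse (T : H₁ →ₗ.[ℂ] H₂) (hd : Dense (T.domain : Set H₁))
    (hc : T.IsClosed) : ∃ R : H₁ →L[ℂ] H₁, IsBoundedInverse (onePlusGram T) R := by
  let e := WithLp.prodContinuousLinearEquiv 2 ℂ H₁ H₂
  let K : Submodule ℂ (WithLp 2 (H₁ × H₂)) := T.graph.comap (e : WithLp 2 (H₁ × H₂) →ₗ[ℂ] H₁ × H₂)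
  have hK : IsClosed (K : Set (WithLp 2 (H₁ × H₂))) := hc.preimage e.continuous
  have : CompleteSpace K := hK.completeSpace_coe
  let R : H₁ →L[ℂ] H₁ := (ContinuousLinearMap.fst ℂ H₁ H₂) ∘L (e : WithLp 2 (H₁ × H₂) →L[ℂ] H₁ × H₂)
    ∘L K.starProjection ∘L (e.symm : H₁ × H₂ →L[ℂ] WithLp 2 (H₁ × H₂)) ∘L
    (ContinuousLinearMap.inl ℂ H₁ H₂)
  have h1 : ∀ y : H₁, ∃ h : R y ∈ (onePlusGram T).domain, onePlusGram T ⟨R y, h⟩ = y := by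
    intro y
    set p := K.starProjection (e.symm (y, 0)) with hp
    have hpK : p ∈ K := Submodule.starProjection_apply_mem K _
    have hR : R y = (e p).1 := rfl
    obtain ⟨z, hz1, hz2⟩ := T.mem_graph_iff.1 (show e p ∈ T.graph from hpK)
    have horth : ∀ u : T.domain, ⟪y - z, (u : H₁)⟫_ℂ = ⟪T z, T u⟫_ℂ := by
      intro u
      have hu : e.symm ((u : H₁), T u) ∈ K := T.mem_graph u
      have := Submodule.starProjection_inner_eq_zero (K := K) (e.symm (y, 0)) _ hu
      rw [← hp, WithLp.prod_inner_apply] at this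
      have a1 : (WithLp.ofLp (e.symm (y, (0 : H₂)) - p)).1 = y - z := by rw [hz1]; rfl
      have a2 : (WithLp.ofLp (e.symm (y, (0 : H₂)) - p)).2 = 0 - T z := by rw [hz2]; rfl
      rw [a1, a2] at this
      have b : ⟪y - z, (u : H₁)⟫_ℂ + ⟪0 - T z, T u⟫_ℂ = 0 := this
      rw [zero_sub, inner_neg_left] at b
      exact sub_eq_zero.1 (by rw [sub_eq_add_neg]; exact b)
    have hmem : T z ∈ T†.domain := LinearPMap.mem_adjoint_domain_of_exists _ ⟨y - z, horth⟩
    have hval : T† ⟨T z, hmem⟩ = y - z := LinearPMap.adjoint_apply_eq hd ⟨T z, hmem⟩ horth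
    have hRz : R y = z := by rw [hR, hz1]
    rw [hRz]
    refine ⟨⟨trivial, z.2, hmem⟩, ?_⟩
    change (z : H₁) + T† ⟨T z, hmem⟩ = y
    rw [hval]; abel
  refine ⟨R, h1, fun x => ?_⟩
  obtain ⟨hm, he⟩ := h1 (onePlusGram T x)
  have h0 : onePlusGram T (⟨_, hm⟩ - x) = 0 := by rw [LinearPMap.map_sub, he, sub_self]
  set w : (onePlusGram T).domain := ⟨_, hm⟩ - x with hw
  have := onePlusGram_inner T hd w ⟨w, w.2.2.fst⟩
  rw [h0, inner_zero_left] at this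
  have h2 := congrArg Complex.re this
  have i1 : (⟪(w : H₁), (w : H₁)⟫_ℂ).re = ‖(w : H₁)‖ ^ 2 := (norm_sq_eq_re_inner (𝕜 := ℂ) _).symm
  have i2 : (⟪T ⟨w, w.2.2.fst⟩, T ⟨w, w.2.2.fst⟩⟫_ℂ).re = ‖T ⟨w, w.2.2.fst⟩‖ ^ 2 :=
    (norm_sq_eq_re_inner (𝕜 := ℂ) _).symm
  rw [Complex.add_re, i1, i2, Complex.zero_re] at h2
  have h3 : ‖(w : H₁)‖ = 0 := by
    have := sq_nonneg ‖T ⟨w, w.2.2.fst⟩‖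
    exact pow_eq_zero_iff (two_ne_zero) |>.1 (le_antisymm (by linarith) (sq_nonneg _))
  have h4 : (w : H₁) = 0 := norm_eq_zero.1 h3
  exact sub_eq_zero.1 h4

/-- The bounded operator `(I + T* T)⁻¹`. -/
noncomputable def invOnePlusGram (T : H₁ →ₗ.[ℂ] H₂) (hd : Dense (T.domain : Set H₁))
    (hc : T.IsClosed) : H₁ →L[ℂ] H₁ :=
  (exists_isBoundedInverse T hd hc).choose

theorem invOnePlusGram_spec (T : H₁ →ₗ.[ℂ] H₂) (hd : Dense (T.domain : Set H₁))
    (hc : T.IsClosed) : IsBoundedInverse (onePlusGram T) (invOnePlusGram T hd hc) :=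
  (exists_isBoundedInverse T hd hc).choose_spec

/-- The bounded operator `Q_T = (I + T* T)^(-1/2)`: the positive square root of the positive
bounded operator `(I + T* T)⁻¹`. -/
noncomputable def invSqrtOnePlusGram (T : H₁ →ₗ.[ℂ] H₂) (hd : Dense (T.domain : Set H₁))
    (hc : T.IsClosed) : H₁ →L[ℂ] H₁ :=
  CFC.sqrt (invOnePlusGram T hd hc)

theorem invOnePlusGram_inner (T : H₁ →ₗ.[ℂ] H₂) (hd : Dense (T.domain : Set H₁))
    (hc : T.IsClosed) (y : H₁) :
    ∃ h : invOnePlusGram T hd hc y ∈ T.domain,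
      ⟪y, invOnePlusGram T hd hc y⟫_ℂ =
        ((‖invOnePlusGram T hd hc y‖ ^ 2 + ‖T ⟨invOnePlusGram T hd hc y, h⟩‖ ^ 2 : ℝ) : ℂ) := by
  obtain ⟨hm, he⟩ := (invOnePlusGram_spec T hd hc).1 y
  refine ⟨hm.2.fst, ?_⟩
  have := onePlusGram_inner T hd ⟨_, hm⟩ ⟨_, hm.2.fst⟩
  rw [he, inner_self_eq_norm_sq_to_K, inner_self_eq_norm_sq_to_K] at this
  rw [this]
  push_cast
  rfl

theorem invOnePlusGram_nonneg (T : H₁ →ₗ.[ℂ] H₂) (hd : Dense (T.domain : Set H₁))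
    (hc : T.IsClosed) : 0 ≤ invOnePlusGram T hd hc := by
  rw [ContinuousLinearMap.nonneg_iff_isPositive, ContinuousLinearMap.isPositive_iff_complex]
  intro y
  obtain ⟨h, e⟩ := invOnePlusGram_inner T hd hc y
  rw [← inner_conj_symm, e, Complex.conj_ofReal]
  exact ⟨rfl, by simp only [RCLike.re_to_complex, Complex.ofReal_re]; positivity⟩

theorem invSqrtOnePlusGram_sq (T : H₁ →ₗ.[ℂ] H₂) (hd : Dense (T.domain : Set H₁))
    (hc : T.IsClosed) (x : H₁) :
    invSqrtOnePlusGram T hd hc (invSqrtOnePlusGram T hd hc x) = invOnePlusGram T hd hc x :=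
  congrArg (fun A : H₁ →L[ℂ] H₁ => A x)
    (CFC.sqrt_mul_sqrt_self (invOnePlusGram T hd hc) (invOnePlusGram_nonneg T hd hc))

theorem invSqrtOnePlusGram_symm (T : H₁ →ₗ.[ℂ] H₂) (hd : Dense (T.domain : Set H₁))
    (hc : T.IsClosed) (x y : H₁) :
    ⟪invSqrtOnePlusGram T hd hc x, y⟫_ℂ = ⟪x, invSqrtOnePlusGram T hd hc y⟫_ℂ :=
  (IsSelfAdjoint.of_nonneg (CFC.sqrt_nonneg (invOnePlusGram T hd hc))).isSymmetric x y

/-- `Q_T` maps `H₁` into `D(T)`, and `‖T Q_T x‖ ≤ ‖x‖`. -/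
theorem invSqrtOnePlusGram_mem (T : H₁ →ₗ.[ℂ] H₂) (hd : Dense (T.domain : Set H₁))
    (hc : T.IsClosed) (x : H₁) :
    ∃ h : invSqrtOnePlusGram T hd hc x ∈ T.domain,
      ‖T ⟨invSqrtOnePlusGram T hd hc x, h⟩‖ ≤ ‖x‖ := by
  set Q := invSqrtOnePlusGram T hd hc with hQ
  have key : ∀ z : H₁, ∃ h : Q (Q z) ∈ T.domain, ‖T ⟨Q (Q z), h⟩‖ ≤ ‖Q z‖ := by
    intro z
    obtain ⟨h, e⟩ := invOnePlusGram_inner T hd hc z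
    have hz : Q (Q z) = invOnePlusGram T hd hc z := invSqrtOnePlusGram_sq T hd hc z
    rw [← hz] at h
    refine ⟨h, ?_⟩
    simp only [← hz] at e
    rw [← invSqrtOnePlusGram_symm, ← hQ, inner_self_eq_norm_sq_to_K] at e
    have e' : ‖Q z‖ ^ 2 = ‖Q (Q z)‖ ^ 2 + ‖T ⟨Q (Q z), h⟩‖ ^ 2 := by
      apply Complex.ofReal_injective
      rw [← e]
      push_cast
      rfl
    exact le_of_sq_le_sq (by nlinarith [sq_nonneg ‖Q (Q z)‖]) (norm_nonneg _)
  have hdense : x ∈ closure (Set.range Q) := by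
    have hort : (LinearMap.range (Q : H₁ →ₗ[ℂ] H₁))ᗮ = ⊥ := by
      rw [Submodule.eq_bot_iff]
      intro v hv
      have hQv : Q v = 0 := by
        apply ext_inner_right ℂ
        intro w
        rw [inner_zero_left, hQ, invSqrtOnePlusGram_symm, ← hQ]
        exact Submodule.inner_left_of_mem_orthogonal
          (LinearMap.mem_range_self (Q : H₁ →ₗ[ℂ] H₁) w) hv
      have hRv : invOnePlusGram T hd hc v = 0 := by
        rw [← invSqrtOnePlusGram_sq, ← hQ, hQv, map_zero]
      obtain ⟨hm, he⟩ := (invOnePlusGram_spec T hd hc).1 v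
      have : (⟨_, hm⟩ : (onePlusGram T).domain) = 0 := Subtype.ext hRv
      rw [← he, this, LinearPMap.map_zero]
    have htop := (Submodule.topologicalClosure_eq_top_iff).2 hort
    have : x ∈ (LinearMap.range (Q : H₁ →ₗ[ℂ] H₁)).topologicalClosure := by
      rw [htop]; trivial
    exact this
  obtain ⟨u, hu, hlim⟩ := mem_closure_iff_seq_limit.1 hdense
  choose z hz using hu
  choose h hle using key
  let t : ℕ → H₂ := fun n => T ⟨Q (Q (z n)), h (z n)⟩
  have hdiff : ∀ m n, dist (t m) (t n) ≤ dist (u m) (u n) := by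
    intro m n
    have h1 : t m - t n = T ⟨Q (Q (z m - z n)), h (z m - z n)⟩ := by
      change T _ - T _ = _
      rw [← LinearPMap.map_sub]
      congr 1
      exact Subtype.ext (by simp [map_sub])
    rw [dist_eq_norm, dist_eq_norm, h1, ← hz, ← hz, ← map_sub]
    exact hle _
  have hcau : CauchySeq t := by
    rw [Metric.cauchySeq_iff]
    intro ε hε
    obtain ⟨N, hN⟩ := Metric.cauchySeq_iff.1 hlim.cauchySeq ε hε
    exact ⟨N, fun m hm n hn => (hdiff m n).trans_lt (hN m hm n hn)⟩
  obtain ⟨y, hy⟩ := cauchySeq_tendsto_of_complete hcau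
  have hlimQ : Tendsto (fun n => Q (Q (z n))) atTop (𝓝 (Q x)) := by
    simp only [hz]
    exact (Q.continuous.tendsto x).comp hlim
  have hgr : (Q x, y) ∈ T.graph :=
    hc.mem_of_tendsto (hlimQ.prodMk_nhds hy)
      (Eventually.of_forall fun n => T.mem_graph ⟨Q (Q (z n)), h (z n)⟩)
  obtain ⟨w, hw1, hw2⟩ := T.mem_graph_iff.1 hgr
  have hw1 : (w : H₁) = Q x := hw1
  have hw2 : T w = y := hw2
  refine ⟨hw1 ▸ w.2, ?_⟩
  have : (⟨Q x, hw1 ▸ w.2⟩ : T.domain) = w := Subtype.ext hw1.symm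
  rw [this, hw2]
  refine le_of_tendsto_of_tendsto hy.norm hlim.norm (Eventually.of_forall fun n => ?_)
  exact (hle (z n)).trans_eq (congrArg norm (hz n))

/-- The bounded transform `F_T = T (I + T* T)^(-1/2)`, an everywhere defined bounded operator. -/
noncomputable def boundedTransform (T : H₁ →ₗ.[ℂ] H₂) (hd : Dense (T.domain : Set H₁))
    (hc : T.IsClosed) : H₁ →L[ℂ] H₂ :=
  LinearMap.mkContinuous
    { toFun := fun x =>
        T ⟨invSqrtOnePlusGram T hd hc x, (invSqrtOnePlusGram_mem T hd hc x).fst⟩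
      map_add' := by
        intro x y
        rw [← LinearPMap.map_add]
        congr 1
        exact Subtype.ext (map_add _ x y)
      map_smul' := by
        intro c x
        rw [RingHom.id_apply, ← LinearPMap.map_smul]
        congr 1
        exact Subtype.ext (map_smul _ c x) }
    1 (fun x => by rw [one_mul]; exact (invSqrtOnePlusGram_mem T hd hc x).snd)

end Transform

end UnboundedOperator

open UnboundedOperator

/-! Write Q = (I + T*T)^(-1/2) and F = TQ. Two facts carry the proof: Q maps H₁ onto D(T)
(`exists_invSqrtOnePlusGram_eq`), and ‖Qx‖² + ‖Fx‖² = ‖x‖² (`norm_sq_invSqrtOnePlusGram_add`). With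
u = Qx, so that Tu = Fx, the ratios r = ‖Tu‖/‖u‖ and s = ‖Fx‖/‖x‖ satisfy s² = r²/(1 + r²). This is
an increasing function of r, so infima correspond to infima and minimizers u to minimizers x. -/

namespace UnboundedOperator

open scoped InnerProductSpace LinearPMap

/-! ### The minimum modulus in homogeneous form -/

section MinModulus

variable {E F : Type*}
  [NormedAddCommGroup E] [InnerProductSpace ℂ E]
  [NormedAddCommGroup F] [InnerProductSpace ℂ F]

theorem minModulus_nonneg (S : E →ₗ.[ℂ] F) : 0 ≤ minModulus S := by
  apply Real.sInf_nonneg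
  rintro r ⟨x, -, rfl⟩
  exact norm_nonneg _

theorem norm_normalize_apply (S : E →ₗ.[ℂ] F) {x : S.domain} (hx : (x : E) ≠ 0) :
    ‖(((‖(x : E)‖⁻¹ : ℂ) • x : S.domain) : E)‖ = 1 ∧
      ‖S ((‖(x : E)‖⁻¹ : ℂ) • x)‖ = ‖S x‖ / ‖(x : E)‖ := by
  have h : ‖(x : E)‖ ≠ 0 := norm_ne_zero_iff.2 hx
  rw [LinearPMap.map_smul, Submodule.coe_smul, norm_smul, norm_smul, norm_inv, Complex.norm_real,
    norm_norm]
  exact ⟨inv_mul_cancel₀ h, by rw [div_eq_inv_mul]⟩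

theorem minModulus_mul_norm_le (S : E →ₗ.[ℂ] F) (x : S.domain) :
    minModulus S * ‖(x : E)‖ ≤ ‖S x‖ := by
  by_cases hx : (x : E) = 0
  · simp [hx]
  obtain ⟨h1, h2⟩ := norm_normalize_apply S hx
  rw [← le_div_iff₀ (norm_pos_iff.2 hx), ← h2]
  refine csInf_le ⟨0, ?_⟩ ⟨_, h1, rfl⟩
  rintro r ⟨y, -, rfl⟩
  exact norm_nonneg _

/-- The nonzero vector is essential: the real infimum of the empty set is 0, which would contradict
a bound with c > 0. -/
theorem le_minModulus (S : E →ₗ.[ℂ] F) (hS : ∃ x : S.domain, (x : E) ≠ 0) {c : ℝ}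
    (h : ∀ x : S.domain, c * ‖(x : E)‖ ≤ ‖S x‖) : c ≤ minModulus S := by
  obtain ⟨x, hx⟩ := hS
  refine le_csInf ⟨_, _, (norm_normalize_apply S hx).1, rfl⟩ ?_
  rintro r ⟨y, hy, rfl⟩
  simpa [hy] using h y

/-- Q does not preserve norms, so unit vectors do not match under u = Qx; the scale-free form does
transfer. -/
theorem isMinAttaining_iff (S : E →ₗ.[ℂ] F) :
    IsMinAttaining S ↔ ∃ x : S.domain, (x : E) ≠ 0 ∧ ‖S x‖ = minModulus S * ‖(x : E)‖ := by
  constructor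
  · rintro ⟨x, hx, h⟩
    refine ⟨x, fun h0 => ?_, by rw [h, hx, mul_one]⟩
    rw [h0, norm_zero] at hx
    exact zero_ne_one hx
  · rintro ⟨x, hx, h⟩
    obtain ⟨h1, h2⟩ := norm_normalize_apply S hx
    refine ⟨_, h1, ?_⟩
    rw [h2, h, mul_div_cancel_right₀ _ (norm_ne_zero_iff.2 hx)]

theorem exists_domain_ne_zero [Nontrivial E] (T : E →ₗ.[ℂ] F)
    (hd : Dense (T.domain : Set E)) : ∃ u : T.domain, (u : E) ≠ 0 := by
  obtain ⟨u, hu, h0⟩ := hd.inter_open_nonempty {0}ᶜ isOpen_compl_singleton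
    (exists_ne (0 : E))
  exact ⟨⟨u, h0⟩, hu⟩

end MinModulus

/-! ### The range of Q and the norm identity -/

section Transform

variable {H₁ H₂ : Type*}
  [NormedAddCommGroup H₁] [InnerProductSpace ℂ H₁] [CompleteSpace H₁]
  [NormedAddCommGroup H₂] [InnerProductSpace ℂ H₂] [CompleteSpace H₂]

theorem boundedTransform_apply (T : H₁ →ₗ.[ℂ] H₂) (hd : Dense (T.domain : Set H₁))
    (hc : T.IsClosed) (x : H₁) (h : invSqrtOnePlusGram T hd hc x ∈ T.domain) :
    boundedTransform T hd hc x = T ⟨invSqrtOnePlusGram T hd hc x, h⟩ :=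
  rfl

/-- This is the weak form of (I + T*T)Q²z = z, tested against u ∈ D(T). -/
theorem inner_add_inner_boundedTransform (T : H₁ →ₗ.[ℂ] H₂) (hd : Dense (T.domain : Set H₁))
    (hc : T.IsClosed) (u : T.domain) (z : H₁) :
    ⟪(u : H₁), invOnePlusGram T hd hc z⟫_ℂ +
      ⟪T u, boundedTransform T hd hc (invSqrtOnePlusGram T hd hc z)⟫_ℂ = ⟪(u : H₁), z⟫_ℂ := by
  obtain ⟨hm, he⟩ := (invOnePlusGram_spec T hd hc).1 z
  have h := onePlusGram_inner T hd ⟨_, hm⟩ u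
  rw [he] at h
  have hF : boundedTransform T hd hc (invSqrtOnePlusGram T hd hc z) =
      T ⟨invOnePlusGram T hd hc z, hm.2.fst⟩ := by
    rw [boundedTransform_apply T hd hc _ (invSqrtOnePlusGram_mem T hd hc _).fst]
    congr 1
    exact Subtype.ext (invSqrtOnePlusGram_sq T hd hc z)
  rw [hF, ← inner_conj_symm (u : H₁) z, h, map_add, inner_conj_symm, inner_conj_symm]

/-- The domain of `T` is the range of `(I + T* T)^(-1/2)`. -/
theorem exists_invSqrtOnePlusGram_eq (T : H₁ →ₗ.[ℂ] H₂) (hd : Dense (T.domain : Set H₁))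
    (hc : T.IsClosed) (u : T.domain) : ∃ x : H₁, invSqrtOnePlusGram T hd hc x = u := by
  -- The witness is forced by Q² + F*F = I: if u = Qx, then Qu + F*(Tu) = Q²x + F*Fx = x.
  refine ⟨invSqrtOnePlusGram T hd hc u +
    ContinuousLinearMap.adjoint (boundedTransform T hd hc) (T u), ?_⟩
  apply ext_inner_right ℂ
  intro z
  rw [invSqrtOnePlusGram_symm, inner_add_left, invSqrtOnePlusGram_symm, invSqrtOnePlusGram_sq,
    ContinuousLinearMap.adjoint_inner_left]
  exact inner_add_inner_boundedTransform T hd hc u z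

/-- Both sides are continuous in x, so x = Qz suffices: the range of Q contains D(T), hence is
dense. There the weak identity with u = Q²z gives the claim. -/
theorem norm_sq_invSqrtOnePlusGram_add (T : H₁ →ₗ.[ℂ] H₂) (hd : Dense (T.domain : Set H₁))
    (hc : T.IsClosed) (x : H₁) :
    ‖invSqrtOnePlusGram T hd hc x‖ ^ 2 + ‖boundedTransform T hd hc x‖ ^ 2 = ‖x‖ ^ 2 := by
  have hrange : (T.domain : Set H₁) ⊆ Set.range (invSqrtOnePlusGram T hd hc) :=
    fun u hu => exists_invSqrtOnePlusGram_eq T hd hc ⟨u, hu⟩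
  refine (hd.mono hrange).induction (P := fun x => ‖invSqrtOnePlusGram T hd hc x‖ ^ 2 +
    ‖boundedTransform T hd hc x‖ ^ 2 = ‖x‖ ^ 2) ?_
    (isClosed_eq (by fun_prop) (by fun_prop)) x
  rintro _ ⟨z, rfl⟩
  have hm := (invSqrtOnePlusGram_mem T hd hc (invSqrtOnePlusGram T hd hc z)).fst
  have h := inner_add_inner_boundedTransform T hd hc ⟨_, hm⟩ z
  rw [← boundedTransform_apply T hd hc _ hm, ← invSqrtOnePlusGram_sq,
    invSqrtOnePlusGram_symm T hd hc _ z, inner_self_eq_norm_sq_to_K, inner_self_eq_norm_sq_to_K,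
    inner_self_eq_norm_sq_to_K] at h
  exact_mod_cast h

/-- If Qx = 0, then Fx = T0 = 0 as well, and the norm identity forces x = 0. -/
theorem invSqrtOnePlusGram_ne_zero_iff (T : H₁ →ₗ.[ℂ] H₂) (hd : Dense (T.domain : Set H₁))
    (hc : T.IsClosed) (x : H₁) : invSqrtOnePlusGram T hd hc x ≠ 0 ↔ x ≠ 0 := by
  refine ⟨fun h hx => h (by rw [hx, map_zero]), fun hx h => hx ?_⟩
  have hm := (invSqrtOnePlusGram_mem T hd hc x).fst
  have h0 : (⟨_, hm⟩ : T.domain) = 0 := Subtype.ext h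
  have hn := norm_sq_invSqrtOnePlusGram_add T hd hc x
  rw [boundedTransform_apply T hd hc x hm, h0, LinearPMap.map_zero, h] at hn
  simpa using hn.symm

/-! ### Comparison of the two minimum moduli -/

variable [Nontrivial H₁]

theorem minModulus_boundedTransform_lt_one (T : H₁ →ₗ.[ℂ] H₂)
    (hd : Dense (T.domain : Set H₁)) (hc : T.IsClosed) :
    minModulus (ofBounded (boundedTransform T hd hc)) < 1 := by
  obtain ⟨x, hx⟩ := exists_ne (0 : H₁)
  have ha := norm_pos_iff.2 ((invSqrtOnePlusGram_ne_zero_iff T hd hc x).2 hx)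
  have hn := norm_sq_invSqrtOnePlusGram_add T hd hc x
  have hle : minModulus (ofBounded (boundedTransform T hd hc)) * ‖x‖ ≤
      ‖boundedTransform T hd hc x‖ :=
    minModulus_mul_norm_le (ofBounded (boundedTransform T hd hc)) ⟨x, trivial⟩
  have hlt : ‖boundedTransform T hd hc x‖ < ‖x‖ :=
    lt_of_pow_lt_pow_left₀ 2 (norm_nonneg _) (by nlinarith [pow_pos ha 2])
  exact lt_of_mul_lt_mul_right (by rw [one_mul]; exact hle.trans_lt hlt) (norm_nonneg x)

theorem sq_minModulus_boundedTransform (T : H₁ →ₗ.[ℂ] H₂)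
    (hd : Dense (T.domain : Set H₁)) (hc : T.IsClosed) :
    minModulus (ofBounded (boundedTransform T hd hc)) ^ 2 * (1 + minModulus T ^ 2) =
      minModulus T ^ 2 := by
  set μ := minModulus (ofBounded (boundedTransform T hd hc)) with hμ
  set m := minModulus T with hm
  have hμ0 : 0 ≤ μ := minModulus_nonneg _
  have hm0 : 0 ≤ m := minModulus_nonneg _
  have hμ1 : μ < 1 := minModulus_boundedTransform_lt_one T hd hc
  have hμ2 : 0 < 1 - μ ^ 2 := by nlinarith
  apply le_antisymm
  -- With a = ‖Qx‖² and b = ‖Fx‖², the bound b ≥ μ²(a + b) rearranges to b ≥ μ²/(1 - μ²) · a, a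
  -- lower bound for T on all of D(T).
  · have hle : √(μ ^ 2 / (1 - μ ^ 2)) ≤ m := by
      refine le_minModulus T (exists_domain_ne_zero T hd) fun u => ?_
      obtain ⟨x, hx⟩ := exists_invSqrtOnePlusGram_eq T hd hc u
      have hu : u = ⟨_, (invSqrtOnePlusGram_mem T hd hc x).fst⟩ := Subtype.ext hx.symm
      have hTu : ‖T u‖ = ‖boundedTransform T hd hc x‖ := by
        rw [hu, ← boundedTransform_apply T hd hc x]
      have hb : μ * ‖x‖ ≤ ‖boundedTransform T hd hc x‖ :=
        minModulus_mul_norm_le (ofBounded (boundedTransform T hd hc)) ⟨x, trivial⟩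
      have hn := norm_sq_invSqrtOnePlusGram_add T hd hc x
      rw [hTu, ← hx]
      have hb2 := pow_le_pow_left₀ (by positivity) hb 2
      refine le_of_sq_le_sq ?_ (norm_nonneg _)
      rw [mul_pow, Real.sq_sqrt (by positivity), div_mul_eq_mul_div, div_le_iff₀ hμ2]
      rw [mul_pow, ← hn] at hb2
      linarith
    have h2 := pow_le_pow_left₀ (Real.sqrt_nonneg _) hle 2
    rw [Real.sq_sqrt (by positivity), div_le_iff₀ hμ2] at h2
    linarith
  -- Conversely, b ≥ m²a gives (1 + m²)b ≥ m²(a + b).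
  · have hle : √(m ^ 2 / (1 + m ^ 2)) ≤ μ := by
      obtain ⟨x₀, hx₀⟩ := exists_ne (0 : H₁)
      refine le_minModulus (ofBounded (boundedTransform T hd hc)) ⟨⟨x₀, trivial⟩, hx₀⟩ ?_
      rintro ⟨x, _⟩
      change _ * ‖x‖ ≤ ‖boundedTransform T hd hc x‖
      have hb : m * ‖invSqrtOnePlusGram T hd hc x‖ ≤ ‖boundedTransform T hd hc x‖ :=
        minModulus_mul_norm_le T ⟨_, (invSqrtOnePlusGram_mem T hd hc x).fst⟩
      have hn := norm_sq_invSqrtOnePlusGram_add T hd hc x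
      have hb2 := pow_le_pow_left₀ (by positivity) hb 2
      refine le_of_sq_le_sq ?_ (norm_nonneg _)
      rw [mul_pow, Real.sq_sqrt (by positivity), div_mul_eq_mul_div, div_le_iff₀ (by positivity)]
      rw [mul_pow] at hb2
      rw [← hn]
      linarith
    have h2 := pow_le_pow_left₀ (Real.sqrt_nonneg _) hle 2
    rwa [Real.sq_sqrt (by positivity), div_le_iff₀ (by positivity)] at h2

theorem norm_boundedTransform_eq_iff (T : H₁ →ₗ.[ℂ] H₂)
    (hd : Dense (T.domain : Set H₁)) (hc : T.IsClosed) (x : H₁) :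
    ‖boundedTransform T hd hc x‖ = minModulus T * ‖invSqrtOnePlusGram T hd hc x‖ ↔
      ‖boundedTransform T hd hc x‖ =
        minModulus (ofBounded (boundedTransform T hd hc)) * ‖x‖ := by
  have hs := sq_minModulus_boundedTransform T hd hc
  have hn := norm_sq_invSqrtOnePlusGram_add T hd hc x
  have hμ0 := minModulus_nonneg (ofBounded (boundedTransform T hd hc))
  have hm0 := minModulus_nonneg T
  rw [← sq_eq_sq₀ (norm_nonneg _) (by positivity), ← sq_eq_sq₀ (norm_nonneg _) (by positivity),
    mul_pow, mul_pow, ← hn]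
  have hpos : (0 : ℝ) < 1 + minModulus T ^ 2 := by positivity
  -- What remains is algebra: given p(1 + q) = q, the equations b = qa and b = p(a + b) are
  -- equivalent.
  generalize minModulus (ofBounded (boundedTransform T hd hc)) ^ 2 = p at *
  generalize minModulus T ^ 2 = q at *
  generalize ‖boundedTransform T hd hc x‖ ^ 2 = b at *
  generalize ‖invSqrtOnePlusGram T hd hc x‖ ^ 2 = a at *
  constructor <;> intro h
  · apply mul_left_cancel₀ hpos.ne'
    linear_combination h - (a + b) * hs
  · linear_combination (1 + q) * h + (a + b) * hs

theorem isMinAttaining_boundedTransform_iff (T : H₁ →ₗ.[ℂ] H₂)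
    (hd : Dense (T.domain : Set H₁)) (hc : T.IsClosed) :
    IsMinAttaining T ↔ IsMinAttaining (ofBounded (boundedTransform T hd hc)) := by
  rw [isMinAttaining_iff, isMinAttaining_iff]
  constructor
  · rintro ⟨u, hu0, hu⟩
    obtain ⟨x, hx⟩ := exists_invSqrtOnePlusGram_eq T hd hc u
    obtain rfl : u = ⟨_, (invSqrtOnePlusGram_mem T hd hc x).fst⟩ := Subtype.ext hx.symm
    exact ⟨⟨x, trivial⟩, (invSqrtOnePlusGram_ne_zero_iff T hd hc x).1 hu0,
      (norm_boundedTransform_eq_iff T hd hc x).1 hu⟩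
  · rintro ⟨⟨x, _⟩, hx0, hx⟩
    exact ⟨⟨_, (invSqrtOnePlusGram_mem T hd hc x).fst⟩,
      (invSqrtOnePlusGram_ne_zero_iff T hd hc x).2 hx0,
      (norm_boundedTransform_eq_iff T hd hc x).2 hx⟩

end Transform

end UnboundedOperator

theorem proposition3p13 {H₁ H₂ : Type*}
    [NormedAddCommGroup H₁] [InnerProductSpace ℂ H₁] [CompleteSpace H₁] [Nontrivial H₁]
    [NormedAddCommGroup H₂] [InnerProductSpace ℂ H₂] [CompleteSpace H₂]
    (T : H₁ →ₗ.[ℂ] H₂) (hd : Dense (T.domain : Set H₁)) (hc : T.IsClosed) :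
    minModulus (ofBounded (boundedTransform T hd hc)) =
        minModulus T / √(1 + minModulus T ^ 2) ∧
      minModulus (ofBounded (boundedTransform T hd hc)) < 1 ∧
      minModulus T ^ 2 =
        minModulus (ofBounded (boundedTransform T hd hc)) ^ 2 /
          (1 - minModulus (ofBounded (boundedTransform T hd hc)) ^ 2) ∧
      (IsMinAttaining T ↔ IsMinAttaining (ofBounded (boundedTransform T hd hc))) := by
  have hs := sq_minModulus_boundedTransform T hd hc
  have hlt := minModulus_boundedTransform_lt_one T hd hc
  have hμ0 := minModulus_nonneg (ofBounded (boundedTransform T hd hc))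
  have hm0 := minModulus_nonneg T
  have hpos : (0 : ℝ) < 1 + minModulus T ^ 2 := by positivity
  refine ⟨?_, hlt, ?_, isMinAttaining_boundedTransform_iff T hd hc⟩
  · rw [← sq_eq_sq₀ hμ0 (by positivity), div_pow, Real.sq_sqrt hpos.le, eq_div_iff hpos.ne', hs]
  · have h1 : 1 - minModulus (ofBounded (boundedTransform T hd hc)) ^ 2 ≠ 0 := by
      nlinarith
    rw [eq_div_iff h1]
    linear_combination -hs
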